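/- **Setting.** Let $S\ge 1$ and let $\eta,\zeta\in\mathbb R\setminus\{0\}$ with $\eta^2+\zeta^2=1$. An input state $\rho$ is a density operator on the bosonic Fock space of $S$ modes with annihilation operators $a_1,\dots,a_S$. A probe occupying $S$ further modes $b_1,\dots,b_S$ is prepared in the coherent state with amplitude vector $\gamma\vec e_1=(\gamma,0,\dots,0)$, $\gamma\in\mathbb C$. Each pair $(a_i,b_i)$ is sent through the same beam splitter, which acts on mode operators as $a_i\mapsto \eta a_i+\zeta b_i$, $b_i\mapsto \zeta a_i-\eta b_i$. One photon counter measures the total number of photons in the $S$ modes of the first output path; let $p_k(\gamma)$, $k=0,1,2,\dots$, be the probabilities of its outcomes. To a polynomial in formal variables $\alpha_i,\alpha_i^*$ ($1\le i\le S$) corresponds the operator obtained by substituting $\alpha_i\to a_i$, $\alpha_i^*\to a_i^\dagger$ in normal order (creation operators to the left). Put $|\vec\alpha|^2=\sum_{i=1}^S\alpha_i\alpha_i^*$, $|\vec\beta|^2=\sum_{i=2}^S\alpha_i\alpha_i^*$, and, for $N\in\mathbb Z_{\ge0}$, $$\mathcal M=\{|\vec\alpha|^{2a}\alpha_1^{b}(\alpha_1^*)^{c}:\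 a+\max(b,c)\le N\},\qquad \mathcal M'=\{|\vec\beta|^{2a}\alpha_1^{b}(\alpha_1^*)^{c}:\ a+\max(b,c)\le N\},$$ with $a,b,c\in\mathbb Z_{\ge 0}$. Let $\mathcal P_N$ be the complex vector space of functions on $\mathbb C$ spanned by the monomials $\gamma^k(\gamma^*)^l$ with $0\le k,l\le N$. **Theorem.** Let $\Gamma\subset\mathbb C$ be a finite set such that every $p\in\mathcal P_N$ that vanishes on $\Gamma$ is zero. Then, for input states with at most $N$ photons, the counter outcome distributions $(p_k(\gamma))_{k\ge0}$ for all $\gamma\in\Gamma$ determine the expectation of the operator corresponding to each member of $\mathcal M$ and of $\mathcal M'$. That is, if two input states with at most $N$ photons have the same counter outcome distributions for every $\gamma\in\Gamma$, then the operator corresponding to any member of $\mathcal M\cup\mathcal M'$ has the same expectation in both. -/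

import Mathlib

noncomputable section

namespace WFH

/-- Occupation numbers of a family of bosonic modes indexed by `ι`. -/
abbrev Occ (ι : Type) : Type := ι → ℕ

/-- The bosonic Fock space of the modes `ι`, as `ℓ²` over the occupation numbers. -/
abbrev Fock (ι : Type) : Type := lp (fun _ : Occ ι => ℂ) 2

/-- The finite-particle vectors: finite linear combinations of Fock states `|n⟩`, a dense subspace
of the Fock space that every polynomial in the mode operators maps to itself. -/
abbrev FiniteVec (ι : Type) : Type := Occ ι →₀ ℂ

variable {ι : Type} [Fintype ι] [DecidableEq ι]

/-- The Fock state `|n⟩` as a unit vector of the Fock space. -/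
def ket (n : Occ ι) : Fock ι := lp.single 2 n (1 : ℂ)

/-- The inclusion of the finite-particle vectors into the Fock space. -/
def toFock : FiniteVec ι →ₗ[ℂ] Fock ι := Finsupp.linearCombination ℂ ket

/-- The creation operator of mode `i`: `aᵢ† |n⟩ = √(nᵢ + 1) |n + eᵢ⟩`. -/
def create (i : ι) : Module.End ℂ (FiniteVec ι) :=
  Finsupp.linearCombination ℂ fun n : Occ ι =>
    ((Real.sqrt (n i + 1) : ℝ) : ℂ) • Finsupp.single (n + Pi.single i 1) (1 : ℂ)

/-- The annihilation operator of mode `i`: `aᵢ |n⟩ = √nᵢ |n - eᵢ⟩`, which is `0` if `nᵢ = 0`. -/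
def annih (i : ι) : Module.End ℂ (FiniteVec ι) :=
  Finsupp.linearCombination ℂ fun n : Occ ι =>
    ((Real.sqrt (n i) : ℝ) : ℂ) • Finsupp.single (n - Pi.single i 1) (1 : ℂ)

/-- `ρ` is a density operator: positive and of trace one. -/
def IsDensity (ρ : Fock ι →L[ℂ] Fock ι) : Prop :=
  ρ.IsPositive ∧ HasSum (fun n : Occ ι => inner ℂ (ket n) (ρ (ket n))) (1 : ℂ)

/-- The state `ρ` has at most `N` photons: it vanishes on all Fock states with more photons. -/
def HasMaxPhotons (N : ℕ) (ρ : Fock ι →L[ℂ] Fock ι) : Prop :=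
  ∀ n : Occ ι, N < ∑ i, n i → ρ (ket n) = 0

/-- The expectation `Tr (ρ O) = ∑ₙ ⟨n| ρ O |n⟩`. For a state with a bounded number of photons only
finitely many terms are non-zero, if `O` is a polynomial in the mode operators. -/
def expectation (ρ : Fock ι →L[ℂ] Fock ι) (O : Module.End ℂ (FiniteVec ι)) : ℂ :=
  ∑' n : Occ ι, inner ℂ (ket n) (ρ (toFock (O (Finsupp.single n 1))))

/-! ### Normal ordering -/

/-- Polynomials in the formal variables `αᵢ` (`Sum.inl i`) and `αᵢ*` (`Sum.inr i`). -/
abbrev Symbol (S : ℕ) : Type := MvPolynomial (Fin S ⊕ Fin S) ℂ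

/-- The formal variable `αᵢ`. -/
def al {S : ℕ} (i : Fin S) : Symbol S := MvPolynomial.X (Sum.inl i)

/-- The formal variable `αᵢ*`. -/
def alStar {S : ℕ} (i : Fin S) : Symbol S := MvPolynomial.X (Sum.inr i)

/-- The operator corresponding to a polynomial in `α, α*`: each monomial
`∏ αᵢ ^ bᵢ (αᵢ*) ^ cᵢ` is replaced by `∏ (aᵢ†) ^ cᵢ ∏ aᵢ ^ bᵢ`. (Within each of the two products
the factors commute, so that their order does not matter.) -/
def normalOrder {S : ℕ} (p : Symbol S) : Module.End ℂ (FiniteVec (Fin S)) :=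
  ∑ s ∈ p.support, p.coeff s •
    ((List.ofFn fun i : Fin S => create i ^ s (Sum.inr i)).prod *
      (List.ofFn fun i : Fin S => annih i ^ s (Sum.inl i)).prod)

/-- `m(a,b,c) = |α|^{2a} α₁^b (α₁*)^c`; the mode written `1` has index `0` here. -/
def mMono {S : ℕ} [NeZero S] (a b c : ℕ) : Symbol S :=
  (∑ i : Fin S, al i * alStar i) ^ a * al 0 ^ b * alStar 0 ^ c

/-- `m'(a,b,c) = |β|^{2a} α₁^b (α₁*)^c`, where `β` consists of all `αᵢ` except `α₁`. -/
def mMono' {S : ℕ} [NeZero S] (a b c : ℕ) : Symbol S :=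
  (∑ i ∈ (Finset.univ : Finset (Fin S)).erase 0, al i * alStar i) ^ a * al 0 ^ b * alStar 0 ^ c

/-- The set `𝓜` of all `m(a,b,c)` with `a + max(b,c) ≤ N`. -/
def setM (S N : ℕ) [NeZero S] : Set (Symbol S) :=
  {p | ∃ a b c : ℕ, a + max b c ≤ N ∧ p = mMono a b c}

/-- The set `𝓜'` of all `m'(a,b,c)` with `a + max(b,c) ≤ N`. -/
def setM' (S N : ℕ) [NeZero S] : Set (Symbol S) :=
  {p | ∃ a b c : ℕ, a + max b c ≤ N ∧ p = mMono' a b c}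

/-! ### The measurement -/

/-- The Fock-basis coefficient `⟨n|v⟩` of the multimode coherent state with amplitudes `v`. -/
def coherentCoeff (v : ι → ℂ) (n : Occ ι) : ℂ :=
  ∏ i, ((Real.exp (-(‖v i‖ ^ 2) / 2) : ℝ) : ℂ) * v i ^ n i / ((Real.sqrt ((n i).factorial) : ℝ) : ℂ)

/-- The modes of the two paths at the beam splitter: `Sum.inl i` is mode `i` of the first path (the
input state, and the measured output), `Sum.inr i` mode `i` of the second path (the probe). -/
abbrev Paths (S : ℕ) : Type := Fin S ⊕ Fin S

/-- Matrix elements `⟨x| ρ ⊗ |v⟩⟨v| |y⟩` of the joint input of the state `ρ` and the coherent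
probe with amplitudes `v`. -/
def jointInput {S : ℕ} (ρ : Fock (Fin S) →L[ℂ] Fock (Fin S)) (v : Fin S → ℂ)
    (x y : Occ (Paths S)) : ℂ :=
  inner ℂ (ket (x ∘ Sum.inl)) (ρ (ket (y ∘ Sum.inl))) *
    (coherentCoeff v (x ∘ Sum.inr) * star (coherentCoeff v (y ∘ Sum.inr)))

/-- The image `U |x⟩` of a Fock state under the beam splitter with the matrix
`!![η, ζ; ζ, -η]` on every pair of modes: `U` fixes the vacuum, `U aᵢ† U⁻¹ = η aᵢ† + ζ bᵢ†`, and
`U bᵢ† U⁻¹ = ζ aᵢ† - η bᵢ†`. -/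
def beamSplitterKet {S : ℕ} (η ζ : ℝ) (x : Occ (Paths S)) : FiniteVec (Paths S) :=
  let A : Fin S → Module.End ℂ (FiniteVec (Paths S)) := fun i =>
    (η : ℂ) • create (Sum.inl i) + (ζ : ℂ) • create (Sum.inr i)
  let B : Fin S → Module.End ℂ (FiniteVec (Paths S)) := fun i =>
    (ζ : ℂ) • create (Sum.inl i) - (η : ℂ) • create (Sum.inr i)
  let W : Module.End ℂ (FiniteVec (Paths S)) :=
    (List.ofFn fun i => A i ^ x (Sum.inl i)).prod * (List.ofFn fun i => B i ^ x (Sum.inr i)).prod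
  ((Real.sqrt (∏ j, ((x j).factorial : ℝ)) : ℝ) : ℂ)⁻¹ • W (Finsupp.single 0 1)

/-- The probability `⟨z| U (ρ ⊗ |v⟩⟨v|) U† |z⟩` of finding the occupation numbers `z` in the output
modes of the beam splitter. Since `U` conserves the total photon number, only finitely many terms
are non-zero. -/
def outputProb {S : ℕ} (η ζ : ℝ) (ρ : Fock (Fin S) →L[ℂ] Fock (Fin S)) (v : Fin S → ℂ)
    (z : Occ (Paths S)) : ℝ :=
  (∑' x : Occ (Paths S), ∑' y : Occ (Paths S),
    beamSplitterKet η ζ x z * jointInput ρ v x y * star (beamSplitterKet η ζ y z)).re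

/-- The probability that the counter, which counts all photons in the modes of the first output
path, shows `k`, for the probe amplitude `γ`: the probe is in the coherent state `γ e₁`. -/
def counterProb {S : ℕ} [NeZero S] (η ζ : ℝ) (ρ : Fock (Fin S) →L[ℂ] Fock (Fin S)) (γ : ℂ)
    (k : ℕ) : ℝ :=
  ∑' z : {z : Occ (Paths S) // ∑ i, z (Sum.inl i) = k}, outputProb η ζ ρ (Pi.single 0 γ) z

/-- The operator corresponding to `p` is observable for input states with at most `N` photons, from
the counter at the probe amplitudes in `Γ`: its expectation is determined by the counter outcome
distributions. -/
def Observable {S : ℕ} [NeZero S] (η ζ : ℝ) (N : ℕ) (Γ : Finset ℂ) (p : Symbol S) : Prop :=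
  ∀ ρ σ : Fock (Fin S) →L[ℂ] Fock (Fin S),
    IsDensity ρ → HasMaxPhotons N ρ → IsDensity σ → HasMaxPhotons N σ →
    (∀ γ ∈ Γ, ∀ k : ℕ, counterProb η ζ ρ γ k = counterProb η ζ σ γ k) →
    expectation ρ (normalOrder p) = expectation σ (normalOrder p)

/-- The space `𝓟_N` of functions on `ℂ` spanned by the monomials `γ^k (γ*)^l` with `k, l ≤ N`. -/
def polySpace (N : ℕ) : Submodule ℂ (ℂ → ℂ) :=
  Submodule.span ℂ {f | ∃ k l : ℕ, k ≤ N ∧ l ≤ N ∧ f = fun γ => γ ^ k * star γ ^ l}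

end WFH

end

/-! The factorial moments of a photon count are expectations of normally ordered powers of the
photon number. Undoing the beam splitter turns the annihilator of output mode i into η aᵢ + ζ vᵢ on
the input, with v = γ e₁, because the coherent probe is an eigenvector of its own annihilators.
Hence the n-th factorial moment of the counter is the expectation of the normally ordered n-th power
of η²|α|² + ηζ(γ*α₁ + γα₁*) + ζ²|γ|² (`hasSum_descFactorial_outVec`, `hasSum_counterProb`). The last
summand is a scalar, so a binomial expansion removes it.

Let e be the difference of the expectations in two states with equal counter distributions. On the
n-th power of the remaining symbol, e is a polynomial in γ and γ* whose coefficient at (γ*)^b γ^c is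
a non-zero multiple of e(m(a,b,c)), where a + b + c = n. Since at most N photons are present,
e(m(a,b,c)) = 0 when a + max(b,c) > N (`momentFunctional_mMono_eq_zero`), so this polynomial lies in
𝓟_N. It vanishes on Γ, hence identically, and then all its coefficients vanish
(`functional_mMono_eq_zero`). The set 𝓜' follows from |β|² = |α|² - α₁α₁*.

Operators act only on finite-particle vectors. The infinite tail of the probe enters through
coordinates of ℓ² vectors, where an annihilator becomes a recursion in the occupation numbers
(`sqrt_mul_outVec`). -/

noncomputable section

set_option linter.unusedSectionVars false

namespace WFH

/-! ### Ladder operators: coordinates, commutators, adjointness. -/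

section Basics

variable {ι : Type} [Fintype ι] [DecidableEq ι]

lemma ket_apply (m n : Occ ι) : (ket m : Fock ι) n = if n = m then 1 else 0 := by
  rw [ket, lp.single_apply]
  by_cases h : n = m
  · subst h; simp
  · simp [h]

lemma inner_ket (n : Occ ι) (f : Fock ι) : inner ℂ (ket n) f = f n := by
  rw [ket, lp.inner_single_left]; simp

lemma toFock_single (n : Occ ι) (c : ℂ) : toFock (Finsupp.single n c) = c • ket n := by
  simp [toFock]

lemma toFock_apply (v : FiniteVec ι) (n : Occ ι) : toFock v n = v n := by
  induction v using Finsupp.induction_linear with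
  | zero => simp
  | add u v hu hv => simp [map_add, hu, hv]
  | single m c =>
    rw [toFock_single]
    simp [ket_apply, Finsupp.single_apply, eq_comm]

lemma annih_apply (i : ι) (v : FiniteVec ι) (n : Occ ι) :
    annih i v n = ((Real.sqrt (n i + 1) : ℝ) : ℂ) * v (n + Pi.single i 1) := by
  induction v using Finsupp.induction_linear with
  | zero => simp
  | add u v hu hv => simp [map_add, hu, hv, mul_add]
  | single m c =>
    simp only [annih, Finsupp.linearCombination_single, Finsupp.smul_apply, smul_eq_mul,
      Finsupp.single_apply]
    by_cases h : m = n + Pi.single i 1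
    · subst h
      simp [mul_comm]
    · rw [if_neg h]
      by_cases h0 : m i = 0
      · simp [h0]
      · rw [if_neg]
        · simp
        · rintro rfl
          apply h
          ext j
          by_cases hj : j = i
          · subst hj; simp; omega
          · simp [hj]

lemma create_apply (i : ι) (v : FiniteVec ι) (n : Occ ι) :
    create i v n = ((Real.sqrt (n i) : ℝ) : ℂ) * v (n - Pi.single i 1) := by
  induction v using Finsupp.induction_linear with
  | zero => simp
  | add u v hu hv => simp [map_add, hu, hv, mul_add]
  | single m c =>
    simp only [create, Finsupp.linearCombination_single, Finsupp.smul_apply, smul_eq_mul,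
      Finsupp.single_apply]
    by_cases h : m + Pi.single i 1 = n
    · subst h
      simp [mul_comm]
    · rw [if_neg h]
      -- For `n i = 0` the truncated subtraction returns `n` itself, but the factor √0 removes the
      -- term.
      by_cases h0 : n i = 0
      · simp [h0]
      · rw [if_neg]
        · simp
        · rintro rfl
          apply h
          ext j
          by_cases hj : j = i
          · subst hj; simp; omega
          · simp [hj]

lemma create_single (i : ι) (n : Occ ι) (c : ℂ) : create i (Finsupp.single n c) =
    (c * ((Real.sqrt (n i + 1) : ℝ) : ℂ)) • Finsupp.single (n + Pi.single i 1) (1 : ℂ) := by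
  simp [create]

lemma annih_single (i : ι) (n : Occ ι) (c : ℂ) : annih i (Finsupp.single n c) =
    (c * ((Real.sqrt (n i) : ℝ) : ℂ)) • Finsupp.single (n - Pi.single i 1) (1 : ℂ) := by
  simp [annih]

lemma occ_add_sub_comm {i j : ι} (h : i ≠ j) (n : Occ ι) :
    n + Pi.single i 1 - Pi.single j 1 = n - Pi.single j 1 + Pi.single i 1 := by
  ext k
  by_cases hi : k = i
  · subst hi; simp [h]
  · simp [hi]

lemma annih_create_of_ne {i j : ι} (h : i ≠ j) (v : FiniteVec ι) :
    annih i (create j v) = create j (annih i v) := by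
  ext n
  rw [annih_apply, create_apply, create_apply, annih_apply, occ_add_sub_comm h]
  simp [h, h.symm]
  ring

lemma annih_create_self (i : ι) (v : FiniteVec ι) :
    annih i (create i v) = create i (annih i v) + v := by
  ext n
  rw [Finsupp.add_apply, annih_apply, create_apply, create_apply, annih_apply, add_tsub_cancel_right]
  rcases Nat.eq_zero_or_pos (n i) with h0 | h0
  · simp [h0]
  · have h1 : n - Pi.single i 1 + Pi.single i 1 = n := by
      ext j
      by_cases hj : j = i
      · subst hj; simp; omega
      · simp [hj]
    have h2 : (((n - Pi.single i 1 : Occ ι) i : ℕ) : ℝ) + 1 = n i := by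
      simp [Nat.cast_sub h0]
    rw [h1, h2]
    have h3 : (((n + Pi.single i 1 : Occ ι) i : ℕ) : ℝ) = n i + 1 := by simp
    rw [h3, ← mul_assoc, ← mul_assoc, ← Complex.ofReal_mul, ← Complex.ofReal_mul,
      Real.mul_self_sqrt (by positivity), Real.mul_self_sqrt (by positivity)]
    push_cast
    ring

lemma annih_create (i j : ι) (v : FiniteVec ι) :
    annih i (create j v) = create j (annih i v) + (if i = j then (1 : ℂ) else 0) • v := by
  by_cases h : i = j
  · subst h; simp [annih_create_self]
  · simp [h, annih_create_of_ne h]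

lemma annih_commute (i j : ι) : Commute (annih i) (annih j) := by
  by_cases h : i = j
  · subst h; rfl
  refine LinearMap.ext fun v => Finsupp.ext fun n => ?_
  simp only [Module.End.mul_apply, annih_apply, Pi.add_apply, Pi.single_eq_of_ne h,
    Pi.single_eq_of_ne (Ne.symm h), add_zero, add_right_comm n]
  ring

lemma create_commute (i j : ι) : Commute (create i) (create j) := by
  by_cases h : i = j
  · subst h; rfl
  refine LinearMap.ext fun v => Finsupp.ext fun n => ?_
  simp only [Module.End.mul_apply, create_apply, Pi.sub_apply, Pi.single_eq_of_ne h,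
    Pi.single_eq_of_ne (Ne.symm h), tsub_zero, tsub_right_comm (a := n)]
  ring

lemma inner_single_toFock (n : Occ ι) (c : ℂ) (v : FiniteVec ι) :
    inner ℂ (toFock (Finsupp.single n c)) (toFock v) = star c * v n := by
  rw [toFock_single, inner_smul_left, inner_ket, toFock_apply]; rfl

lemma inner_create_left (i : ι) (u v : FiniteVec ι) :
    inner ℂ (toFock (create i u)) (toFock v) = inner ℂ (toFock u) (toFock (annih i v)) := by
  induction u using Finsupp.induction_linear with
  | zero => simp
  | add u w hu hw => simp only [map_add, inner_add_left, hu, hw]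
  | single n c =>
    rw [create_single, Finsupp.smul_single, inner_single_toFock, inner_single_toFock, annih_apply]
    simp [mul_assoc]

lemma inner_create_right (i : ι) (u v : FiniteVec ι) :
    inner ℂ (toFock u) (toFock (create i v)) = inner ℂ (toFock (annih i u)) (toFock v) := by
  rw [← inner_conj_symm, inner_create_left, inner_conj_symm]

/-- The finite-particle vectors are generated from the vacuum by the creation operators. -/
lemma finiteVec_induction (p : Submodule ℂ (FiniteVec ι)) (h0 : Finsupp.single 0 1 ∈ p)
    (hc : ∀ i, ∀ v ∈ p, create i v ∈ p) (v : FiniteVec ι) : v ∈ p := by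
  have key : ∀ (k : ℕ) (n : Occ ι), ∑ i, n i = k → Finsupp.single n (1 : ℂ) ∈ p := by
    intro k
    induction k with
    | zero =>
      intro n hn
      have : n = 0 := by
        ext i
        simpa using (Finset.sum_eq_zero_iff.mp hn) i (Finset.mem_univ i)
      rw [this]; exact h0
    | succ k ih =>
      intro n hn
      obtain ⟨i, hi⟩ : ∃ i, n i ≠ 0 := by
        by_contra! h
        simp [h] at hn
      have h1 : n - Pi.single i 1 + Pi.single i 1 = n := by
        ext j
        by_cases hj : j = i
        · subst hj; simp; omega
        · simp [hj]
      have h2 : ∑ j, (n - Pi.single i 1 : Occ ι) j = k := by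
        have := congrArg (fun m : Occ ι => ∑ j, m j) h1
        simp only [Pi.add_apply, Finset.sum_add_distrib, Finset.sum_pi_single', hn] at this
        simpa using this
      have h3 := hc i _ (ih _ h2)
      rw [create_single, h1, one_mul] at h3
      refine (p.smul_mem_iff ?_).mp h3
      rw [Complex.ofReal_ne_zero]
      exact (Real.sqrt_pos.mpr (by positivity)).ne'
  induction v using Finsupp.induction_linear with
  | zero => exact p.zero_mem
  | add u v hu hv => exact p.add_mem hu hv
  | single n c =>
    have := p.smul_mem c (key _ n rfl)
    rwa [Finsupp.smul_single, smul_eq_mul, mul_one] at this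

/-- Serves both the words defining the beam splitter and the normally ordered words: by
commutativity the extra factor can be pulled to the front. -/
lemma list_prod_ofFn_pow_add_single {M : Type*} [Monoid M] {n : ℕ} (f : Fin n → M)
    (hf : ∀ i j, Commute (f i) (f j)) (x : Fin n → ℕ) (j : Fin n) :
    (List.ofFn fun i => f i ^ (x + Pi.single j 1 : Fin n → ℕ) i).prod =
      f j * (List.ofFn fun i => f i ^ x i).prod := by
  induction n with
  | zero => exact j.elim0
  | succ n ih =>
    rw [List.ofFn_succ, List.ofFn_succ, List.prod_cons, List.prod_cons]
    cases j using Fin.cases with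
    | zero =>
      simp [pow_succ', mul_assoc]
    | succ j =>
      have h := ih (fun i => f i.succ) (fun i k => hf _ _) (fun i => x i.succ) j
      have e : (fun i : Fin n => f i.succ ^ (x + Pi.single j.succ 1 : Fin (n+1) → ℕ) i.succ) =
          fun i => f i.succ ^ ((fun i => x i.succ) + Pi.single j 1 : Fin n → ℕ) i := by
        ext i
        simp [Pi.single_apply]
      rw [e, h, ← mul_assoc, ← mul_assoc]
      simp [((hf 0 j.succ).pow_left (x 0)).eq]

lemma commute_list_prod_ofFn_pow {M : Type*} [Monoid M] {n : ℕ} (f : Fin n → M) (g : M)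
    (hf : ∀ i, Commute g (f i)) (x : Fin n → ℕ) :
    Commute g (List.ofFn fun i => f i ^ x i).prod := by
  refine Commute.list_prod_right _ _ fun y hy => ?_
  obtain ⟨i, rfl⟩ := List.mem_ofFn.mp hy
  exact (hf i).pow_right _

end Basics

/-! ### The beam splitter as an isometry on finite-particle vectors. -/

section BeamSplitter

variable {S : ℕ} (η ζ : ℝ)

/-- The image of a creation operator under the beam splitter. -/
def bsCreate : Paths S → Module.End ℂ (FiniteVec (Paths S)) :=
  Sum.elim (fun i => (η : ℂ) • create (Sum.inl i) + (ζ : ℂ) • create (Sum.inr i))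
    (fun i => (ζ : ℂ) • create (Sum.inl i) - (η : ℂ) • create (Sum.inr i))

/-- The image of an annihilation operator under the beam splitter. -/
def bsAnnih : Paths S → Module.End ℂ (FiniteVec (Paths S)) :=
  Sum.elim (fun i => (η : ℂ) • annih (Sum.inl i) + (ζ : ℂ) • annih (Sum.inr i))
    (fun i => (ζ : ℂ) • annih (Sum.inl i) - (η : ℂ) • annih (Sum.inr i))

/-- The matrix of the beam splitter on all modes. -/
def bsMatrix (j k : Paths S) : ℂ :=
  Sum.elim (fun i => Sum.elim (fun l => if i = l then (η : ℂ) else 0)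
      (fun l => if i = l then (ζ : ℂ) else 0) k)
    (fun i => Sum.elim (fun l => if i = l then (ζ : ℂ) else 0)
      (fun l => if i = l then -(η : ℂ) else 0) k) j

lemma bsCreate_commute (j k : Paths S) : Commute (bsCreate η ζ j) (bsCreate η ζ k) := by
  -- One common shape for both paths avoids a case split on each pair of modes.
  have h : ∀ j, ∃ (c d : ℂ) (l m : Paths S), ∀ v,
      bsCreate η ζ j v = c • create l v + d • create m v := by
    rintro (i | i)
    · exact ⟨η, ζ, Sum.inl i, Sum.inr i, fun v => rfl⟩
    · refine ⟨ζ, -η, Sum.inl i, Sum.inr i, fun v => ?_⟩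
      simp only [bsCreate, Sum.elim_inr, LinearMap.sub_apply, LinearMap.smul_apply]
      module
  have hc : ∀ (l m : Paths S) v, create l (create m v) = create m (create l v) := fun l m v =>
    LinearMap.congr_fun (create_commute l m) v
  obtain ⟨c, d, l, m, e⟩ := h j
  obtain ⟨c', d', l', m', e'⟩ := h k
  refine LinearMap.ext fun v => ?_
  simp only [Module.End.mul_apply, e, e', map_add, map_smul, hc l' l, hc l' m, hc m' l, hc m' m]
  module

lemma annih_bsCreate (k j : Paths S) (v : FiniteVec (Paths S)) :
    annih k (bsCreate η ζ j v) = bsCreate η ζ j (annih k v) + bsMatrix η ζ k j • v := by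
  rcases j with i | i <;> rcases k with l | l <;>
  simp only [bsCreate, bsMatrix, Sum.elim_inl, Sum.elim_inr, LinearMap.add_apply,
    LinearMap.sub_apply, LinearMap.smul_apply, map_add, map_sub, map_smul, annih_create] <;>
  by_cases h : l = i <;> simp [h] <;> module

/-- The commutator is the same scalar as in `annih_bsCreate`, because the matrix of the beam
splitter is symmetric; the induction for `annih_bsOp` rests on this. -/
lemma bsAnnih_create (k j : Paths S) (v : FiniteVec (Paths S)) :
    bsAnnih η ζ k (create j v) = create j (bsAnnih η ζ k v) + bsMatrix η ζ k j • v := by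
  rcases j with i | i <;> rcases k with l | l <;>
  simp only [bsAnnih, bsMatrix, Sum.elim_inl, Sum.elim_inr, LinearMap.add_apply,
    LinearMap.sub_apply, LinearMap.smul_apply, map_add, map_sub, map_smul, annih_create] <;>
  by_cases h : l = i <;> simp [h] <;> module

lemma inner_bsCreate_left (j : Paths S) (u v : FiniteVec (Paths S)) :
    inner ℂ (toFock (bsCreate η ζ j u)) (toFock v) =
      inner ℂ (toFock u) (toFock (bsAnnih η ζ j v)) := by
  rcases j with i | i <;>
  simp only [bsCreate, bsAnnih, Sum.elim_inl, Sum.elim_inr, LinearMap.add_apply,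
    LinearMap.sub_apply, LinearMap.smul_apply, map_add, map_sub, map_smul, inner_add_left,
    inner_sub_left, inner_smul_left, inner_create_left, inner_add_right, inner_sub_right,
    inner_smul_right, Complex.conj_ofReal]

/-- The beam splitter as an operator on the finite-particle vectors. -/
def bsOp : Module.End ℂ (FiniteVec (Paths S)) :=
  Finsupp.linearCombination ℂ (beamSplitterKet η ζ)

lemma bsOp_single (x : Occ (Paths S)) :
    bsOp η ζ (Finsupp.single x 1) = beamSplitterKet η ζ x := by
  simp [bsOp]

lemma bsOp_vacuum :
    bsOp η ζ (Finsupp.single (0 : Occ (Paths S)) 1) = Finsupp.single 0 1 := by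
  rw [bsOp_single]
  simp [beamSplitterKet]

lemma beamSplitterKet_eq (x : Occ (Paths S)) : beamSplitterKet η ζ x =
    ((Real.sqrt (∏ j, ((x j).factorial : ℝ)) : ℝ) : ℂ)⁻¹ •
      ((List.ofFn fun i => bsCreate η ζ (Sum.inl i) ^ x (Sum.inl i)).prod *
        (List.ofFn fun i => bsCreate η ζ (Sum.inr i) ^ x (Sum.inr i)).prod) (Finsupp.single 0 1) :=
  rfl

lemma prod_factorial_add_single {ι : Type} [Fintype ι] [DecidableEq ι] (x : Occ ι) (j : ι) :
    (∏ k, (((x + Pi.single j 1 : Occ ι) k).factorial : ℝ)) =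
      (x j + 1) * ∏ k, ((x k).factorial : ℝ) := by
  rw [← Finset.mul_prod_erase _ _ (Finset.mem_univ j),
    ← Finset.mul_prod_erase _ (fun k => ((x k).factorial : ℝ)) (Finset.mem_univ j), ← mul_assoc]
  congr 1
  · simp [Nat.factorial_succ]
  · refine Finset.prod_congr rfl fun k hk => ?_
    simp [Finset.ne_of_mem_erase hk]

lemma bsWord_add_single (x : Occ (Paths S)) (j : Paths S) :
    (List.ofFn fun i => bsCreate η ζ (Sum.inl i) ^
        (x + Pi.single j 1 : Occ (Paths S)) (Sum.inl i)).prod *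
      (List.ofFn fun i => bsCreate η ζ (Sum.inr i) ^
        (x + Pi.single j 1 : Occ (Paths S)) (Sum.inr i)).prod =
    bsCreate η ζ j * ((List.ofFn fun i => bsCreate η ζ (Sum.inl i) ^ x (Sum.inl i)).prod *
        (List.ofFn fun i => bsCreate η ζ (Sum.inr i) ^ x (Sum.inr i)).prod) := by
  have hA := list_prod_ofFn_pow_add_single (fun i : Fin S => bsCreate η ζ (Sum.inl i))
    (fun _ _ => bsCreate_commute η ζ _ _) (fun i => x (Sum.inl i))
  have hB := list_prod_ofFn_pow_add_single (fun i : Fin S => bsCreate η ζ (Sum.inr i))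
    (fun _ _ => bsCreate_commute η ζ _ _) (fun i => x (Sum.inr i))
  rcases j with l | l
  · rw [← mul_assoc, ← hA]
    simp [Pi.single_apply]
  · have hc := commute_list_prod_ofFn_pow (fun i : Fin S => bsCreate η ζ (Sum.inl i))
      (bsCreate η ζ (Sum.inr l)) (fun _ => bsCreate_commute η ζ _ _) (fun i => x (Sum.inl i))
    rw [← mul_assoc, hc.eq, mul_assoc, ← hB]
    simp [Pi.single_apply]

/-- The word gains one factor, and the normalisation √(∏ xⱼ!) changes by exactly the √(xⱼ + 1) of
the creation operator. -/
lemma bsOp_create (j : Paths S) (v : FiniteVec (Paths S)) :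
    bsOp η ζ (create j v) = bsCreate η ζ j (bsOp η ζ v) := by
  induction v using Finsupp.induction_linear with
  | zero => simp
  | add u v hu hv => simp only [map_add, hu, hv]
  | single x c =>
    have hc : Finsupp.single x c = c • Finsupp.single x (1 : ℂ) := by simp
    rw [hc, map_smul, map_smul, map_smul, map_smul, create_single, map_smul, bsOp_single,
      bsOp_single, beamSplitterKet_eq, beamSplitterKet_eq, bsWord_add_single,
      prod_factorial_add_single, map_smul, Module.End.mul_apply, smul_smul (_ * _)]
    congr 2
    rw [Real.sqrt_mul (by positivity)]
    push_cast
    have : ((Real.sqrt (x j + 1) : ℝ) : ℂ) ≠ 0 := by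
      rw [Complex.ofReal_ne_zero]; exact (Real.sqrt_pos.mpr (by positivity)).ne'
    field_simp

lemma annih_vacuum {ι : Type} [Fintype ι] [DecidableEq ι] (i : ι) :
    annih i (Finsupp.single 0 1) = 0 := by
  simp [annih_single]

lemma annih_bsOp (k : Paths S) (v : FiniteVec (Paths S)) :
    annih k (bsOp η ζ v) = bsOp η ζ (bsAnnih η ζ k v) := by
  refine finiteVec_induction
    (LinearMap.eqLocus (annih k * bsOp η ζ) (bsOp η ζ * bsAnnih η ζ k)) ?_ ?_ v
  · rw [LinearMap.mem_eqLocus, Module.End.mul_apply, Module.End.mul_apply, bsOp_vacuum]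
    rcases k with i | i <;> simp [bsAnnih, annih_vacuum]
  · intro j v hv
    rw [LinearMap.mem_eqLocus, Module.End.mul_apply, Module.End.mul_apply] at hv ⊢
    rw [bsOp_create, annih_bsCreate, hv, bsAnnih_create, map_add, map_smul, bsOp_create]

variable {η ζ}

/-- By `annih_bsOp` the mode matrix is applied twice, and it is an involution since η² + ζ² = 1. -/
lemma bsOp_bsAnnih_twice (hunit : η ^ 2 + ζ ^ 2 = 1) (j : Paths S) (v : FiniteVec (Paths S)) :
    bsAnnih η ζ j (bsOp η ζ v) = bsOp η ζ (annih j v) := by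
  have h : (η : ℂ) ^ 2 + (ζ : ℂ) ^ 2 = 1 := by exact_mod_cast hunit
  rcases j with i | i <;>
  · simp only [bsAnnih, Sum.elim_inl, Sum.elim_inr, LinearMap.add_apply,
      LinearMap.sub_apply, LinearMap.smul_apply, annih_bsOp, map_add, map_sub, map_smul]
    match_scalars <;> first | linear_combination h | ring

lemma bsOp_apply_zero (v : FiniteVec (Paths S)) : bsOp η ζ v 0 = v 0 := by
  refine finiteVec_induction
    (LinearMap.eqLocus (Finsupp.lapply 0 ∘ₗ bsOp η ζ) (Finsupp.lapply 0)) ?_ ?_ v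
  · simp [LinearMap.mem_eqLocus, bsOp_vacuum]
  · intro j v _
    rw [LinearMap.mem_eqLocus, LinearMap.comp_apply, bsOp_create]
    rcases j with i | i <;> simp [bsCreate, create_apply]

/-- Creation operators in the left argument are moved across as annihilators, one at a time, until
only the vacuum remains. -/
lemma inner_bsOp (hunit : η ^ 2 + ζ ^ 2 = 1) (u v : FiniteVec (Paths S)) :
    inner ℂ (toFock (bsOp η ζ u)) (toFock (bsOp η ζ v)) = inner ℂ (toFock u) (toFock v) := by
  -- The pairing is conjugate-linear in `u`, so this is not an equalizer of linear maps and the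
  -- submodule is built by hand.
  let p : Submodule ℂ (FiniteVec (Paths S)) :=
    { carrier := {u | ∀ v, inner ℂ (toFock (bsOp η ζ u)) (toFock (bsOp η ζ v)) =
        inner ℂ (toFock u) (toFock v)}
      zero_mem' := by simp
      add_mem' := fun {a b} ha hb v => by simp only [map_add, inner_add_left, ha v, hb v]
      smul_mem' := fun c a ha v => by simp only [map_smul, inner_smul_left, ha v] }
  refine finiteVec_induction p ?_ ?_ u v
  · intro v
    rw [bsOp_vacuum, inner_single_toFock, inner_single_toFock, bsOp_apply_zero]
  · intro j u hu v
    rw [bsOp_create, inner_bsCreate_left, bsOp_bsAnnih_twice hunit, hu, inner_create_left]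

lemma orthonormal_beamSplitterKet (hunit : η ^ 2 + ζ ^ 2 = 1) :
    Orthonormal ℂ fun x : Occ (Paths S) => toFock (beamSplitterKet η ζ x) := by
  rw [orthonormal_iff_ite]
  intro x y
  rw [← bsOp_single, ← bsOp_single, inner_bsOp hunit, inner_single_toFock, Finsupp.single_apply]
  simp [eq_comm]

/-- The recursion for the matrix elements of the beam splitter. -/
lemma sqrt_mul_beamSplitterKet (x z : Occ (Paths S)) (i : Fin S) :
    ((Real.sqrt (z (Sum.inl i) + 1) : ℝ) : ℂ) *
        beamSplitterKet η ζ x (z + Pi.single (Sum.inl i) 1) =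
      (η : ℂ) * (((Real.sqrt (x (Sum.inl i)) : ℝ) : ℂ) *
          beamSplitterKet η ζ (x - Pi.single (Sum.inl i) 1) z) +
        (ζ : ℂ) * (((Real.sqrt (x (Sum.inr i)) : ℝ) : ℂ) *
          beamSplitterKet η ζ (x - Pi.single (Sum.inr i) 1) z) := by
  rw [← annih_apply, ← bsOp_single, annih_bsOp]
  simp only [bsAnnih, Sum.elim_inl, LinearMap.add_apply, LinearMap.smul_apply, map_add, map_smul,
    annih_single, one_mul, bsOp_single, Finsupp.add_apply, Finsupp.smul_apply, smul_eq_mul]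

end BeamSplitter

/-! ### The coherent probe and the joint output vector. -/

section Coherent

/-- Reindexing by x ↦ x + eⱼ misses only the terms with xⱼ = 0. -/
lemma hasSum_shift_iff {ι : Type} [Fintype ι] [DecidableEq ι] (j : ι) {f : Occ ι → ℂ}
    (hf : ∀ x, x j = 0 → f x = 0) (a : ℂ) :
    HasSum (fun x : Occ ι => f (x + Pi.single j 1)) a ↔ HasSum f a := by
  refine Function.Injective.hasSum_iff (g := fun x : Occ ι => x + Pi.single j 1)
    (add_left_injective _) fun x hx => hf x ?_
  by_contra h
  refine hx ⟨x - Pi.single j 1, ?_⟩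
  ext k
  by_cases hk : k = j
  · subst hk; simp; omega
  · simp [hk]

lemma sqrt_mul_coherentCoeff {ι : Type} [Fintype ι] [DecidableEq ι] (v : ι → ℂ) (y : Occ ι)
    (i : ι) : ((Real.sqrt (y i + 1) : ℝ) : ℂ) * coherentCoeff v (y + Pi.single i 1) =
      v i * coherentCoeff v y := by
  have h : ((Real.sqrt (y i + 1) : ℝ) : ℂ) ≠ 0 := by
    rw [Complex.ofReal_ne_zero]; exact (Real.sqrt_pos.mpr (by positivity)).ne'
  have h' : ((Real.sqrt ((y i).factorial) : ℝ) : ℂ) ≠ 0 := by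
    rw [Complex.ofReal_ne_zero]; exact (Real.sqrt_pos.mpr (by positivity)).ne'
  unfold coherentCoeff
  rw [← Finset.mul_prod_erase _ _ (Finset.mem_univ i),
    ← Finset.mul_prod_erase (Finset.univ) (fun i => ((Real.exp (-(‖v i‖ ^ 2) / 2) : ℝ) : ℂ) *
      v i ^ y i / ((Real.sqrt ((y i).factorial) : ℝ) : ℂ)) (Finset.mem_univ i),
    ← mul_assoc, ← mul_assoc]
  congr 1
  · simp only [Pi.add_apply, Pi.single_eq_same, Nat.factorial_succ, Nat.cast_mul, Nat.cast_add,
      Nat.cast_one]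
    rw [Real.sqrt_mul (by positivity)]
    push_cast
    field_simp
    ring
  · refine Finset.prod_congr rfl fun k hk => ?_
    simp [Finset.ne_of_mem_erase hk]

variable {S : ℕ} [NeZero S]

lemma coherentCoeff_single_single (γ : ℂ) (p : ℕ) :
    coherentCoeff (Pi.single 0 γ : Fin S → ℂ) (Pi.single 0 p) =
      ((Real.exp (-(‖γ‖ ^ 2) / 2) : ℝ) : ℂ) * γ ^ p / ((Real.sqrt (p.factorial) : ℝ) : ℂ) := by
  unfold coherentCoeff
  rw [Finset.prod_eq_single 0]
  · simp
  · intro i _ hi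
    simp [hi]
  · simp

lemma coherentCoeff_single_of_ne (γ : ℂ) {y : Occ (Fin S)} {i : Fin S} (hi : i ≠ 0)
    (hy : y i ≠ 0) : coherentCoeff (Pi.single 0 γ : Fin S → ℂ) y = 0 := by
  unfold coherentCoeff
  refine Finset.prod_eq_zero (Finset.mem_univ i) ?_
  simp [hi, hy]

lemma hasSum_coherentCoeff (γ : ℂ) : HasSum (fun y : Occ (Fin S) =>
    ‖coherentCoeff (Pi.single 0 γ : Fin S → ℂ) y‖ ^ 2) 1 := by
  -- Only multiples of e₁ contribute, and there the squared coefficients form the Poisson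
  -- distribution of mean ‖γ‖².
  rw [← Function.Injective.hasSum_iff (g := fun p : ℕ => (Pi.single 0 p : Occ (Fin S)))
    (fun p q h => by simpa using congrFun h 0)]
  · have h := (NormedSpace.expSeries_div_hasSum_exp (‖γ‖ ^ 2 : ℝ)).mul_left
      (Real.exp (-(‖γ‖ ^ 2)))
    rw [← Real.exp_eq_exp_ℝ, ← Real.exp_add, neg_add_cancel, Real.exp_zero] at h
    refine h.congr_fun fun p => ?_
    rw [Function.comp_apply, coherentCoeff_single_single, norm_div, norm_mul, norm_pow,
      Complex.norm_real, Complex.norm_real, Real.norm_of_nonneg (Real.exp_nonneg _),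
      Real.norm_of_nonneg (Real.sqrt_nonneg _), div_pow, mul_pow, Real.sq_sqrt (by positivity),
      ← Real.exp_nat_mul]
    push_cast
    rw [mul_div_cancel₀ _ (two_ne_zero), mul_div_assoc, ← pow_mul, ← pow_mul, mul_comm p]
  · intro y hy
    obtain ⟨i, hi, h⟩ : ∃ i, i ≠ 0 ∧ y i ≠ 0 := by
      by_contra! h
      refine hy ⟨y 0, funext fun i => ?_⟩
      by_cases hi : i = 0
      · subst hi; simp
      · simp [hi, h i hi]
    simp [coherentCoeff_single_of_ne γ hi h]

lemma sum_elim_injective (m : Occ (Fin S)) :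
    Function.Injective fun y : Occ (Fin S) => (Sum.elim m y : Occ (Paths S)) := fun y y' h => by
  funext i
  simpa using congrFun h (Sum.inr i)

lemma hasSum_extend (m : Occ (Fin S)) {E : Type*} [NormedAddCommGroup E] {f : Occ (Fin S) → E}
    {a : E} (hf : HasSum f a) :
    HasSum (fun x : Occ (Paths S) => if x ∘ Sum.inl = m then f (x ∘ Sum.inr) else 0) a := by
  rw [← Function.Injective.hasSum_iff (sum_elim_injective m)]
  · refine hf.congr_fun fun y => ?_
    simp
  · intro x hx
    rw [if_neg]
    rintro rfl
    exact hx ⟨x ∘ Sum.inr, Sum.elim_comp_inl_inr x⟩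

/-- The Fock state `|m⟩` in the first path, together with the coherent probe in the second. -/
def jointKet (γ : ℂ) (m : Occ (Fin S)) : Fock (Paths S) :=
  ⟨fun x => if x ∘ Sum.inl = m then
    coherentCoeff (Pi.single 0 γ : Fin S → ℂ) (x ∘ Sum.inr) else 0, by
    refine memℓp_gen ?_
    refine (hasSum_extend m (hasSum_coherentCoeff γ)).summable.congr fun x => ?_
    by_cases h : x ∘ Sum.inl = m <;> simp [h]⟩

lemma jointKet_apply (γ : ℂ) (m : Occ (Fin S)) (x : Occ (Paths S)) :
    jointKet γ m x = if x ∘ Sum.inl = m then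
      coherentCoeff (Pi.single 0 γ : Fin S → ℂ) (x ∘ Sum.inr) else 0 := rfl

lemma inner_jointKet (γ : ℂ) (m n : Occ (Fin S)) :
    inner ℂ (jointKet γ m) (jointKet γ n) = if m = n then 1 else 0 := by
  refine (lp.hasSum_inner (jointKet γ m) (jointKet γ n)).unique ?_
  simp only [jointKet_apply]
  by_cases h : m = n
  · subst h
    rw [if_pos rfl]
    have h1 := hasSum_extend m (Complex.hasSum_ofReal.mpr (hasSum_coherentCoeff (S := S) γ))
    rw [Complex.ofReal_one] at h1
    refine h1.congr_fun fun x => ?_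
    by_cases hx : x ∘ Sum.inl = m
    · simp [hx]
    · simp [hx]
  · rw [if_neg h]
    refine hasSum_zero.congr_fun fun x => ?_
    by_cases hx : x ∘ Sum.inl = m
    · rw [if_neg (c := x ∘ Sum.inl = n) (fun h' => h (hx.symm.trans h'))]; simp
    · rw [if_neg hx]; simp

/-- A finite-particle input vector together with the coherent probe. -/
def jointVec (γ : ℂ) : FiniteVec (Fin S) →ₗ[ℂ] Fock (Paths S) :=
  Finsupp.linearCombination ℂ (jointKet γ)

lemma jointVec_apply (γ : ℂ) (v : FiniteVec (Fin S)) (x : Occ (Paths S)) :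
    jointVec γ v x =
      v (x ∘ Sum.inl) * coherentCoeff (Pi.single 0 γ : Fin S → ℂ) (x ∘ Sum.inr) := by
  induction v using Finsupp.induction_linear with
  | zero => simp
  | add u v hu hv => simp [map_add, hu, hv, add_mul]
  | single m c =>
    simp [jointVec, jointKet_apply, Finsupp.single_apply, eq_comm]

lemma inner_jointVec (γ : ℂ) (u v : FiniteVec (Fin S)) :
    inner ℂ (jointVec γ u) (jointVec γ v) = inner ℂ (toFock u) (toFock v) := by
  induction u using Finsupp.induction_linear with
  | zero => simp
  | add u w hu hw => simp only [map_add, inner_add_left, hu, hw]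
  | single m c =>
    induction v using Finsupp.induction_linear with
    | zero => simp
    | add u w hu hw => simp only [map_add, inner_add_right, hu, hw]
    | single n d =>
      rw [inner_single_toFock]
      simp [jointVec, inner_jointKet, Finsupp.single_apply, eq_comm, mul_comm]

lemma sqrt_mul_jointVec_inl (γ : ℂ) (v : FiniteVec (Fin S)) (x : Occ (Paths S)) (i : Fin S) :
    ((Real.sqrt (x (Sum.inl i) + 1) : ℝ) : ℂ) * jointVec γ v (x + Pi.single (Sum.inl i) 1) =
      jointVec γ (annih i v) x := by
  have h1 : (x + Pi.single (Sum.inl i) 1 : Occ (Paths S)) ∘ Sum.inl =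
      x ∘ Sum.inl + Pi.single i 1 := by
    ext k; simp [Pi.single_apply]
  have h2 : (x + Pi.single (Sum.inl i) 1 : Occ (Paths S)) ∘ Sum.inr = x ∘ Sum.inr := by
    ext k; simp
  rw [jointVec_apply, jointVec_apply, annih_apply, h1, h2, ← mul_assoc]
  rfl

lemma sqrt_mul_jointVec_inr (γ : ℂ) (v : FiniteVec (Fin S)) (x : Occ (Paths S)) (i : Fin S) :
    ((Real.sqrt (x (Sum.inr i) + 1) : ℝ) : ℂ) * jointVec γ v (x + Pi.single (Sum.inr i) 1) =
      (Pi.single 0 γ : Fin S → ℂ) i * jointVec γ v x := by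
  have h1 : (x + Pi.single (Sum.inr i) 1 : Occ (Paths S)) ∘ Sum.inr =
      x ∘ Sum.inr + Pi.single i 1 := by
    ext k; simp [Pi.single_apply]
  have h2 : (x + Pi.single (Sum.inr i) 1 : Occ (Paths S)) ∘ Sum.inl = x ∘ Sum.inl := by
    ext k; simp
  rw [jointVec_apply, jointVec_apply, h1, h2, mul_left_comm, mul_left_comm _ (v _)]
  congr 1
  exact sqrt_mul_coherentCoeff _ (x ∘ Sum.inr) i

variable {η ζ : ℝ}

/-- The beam splitter as an isometry of the Fock space. -/
def bsIsometry (hunit : η ^ 2 + ζ ^ 2 = 1) : Fock (Paths S) →ₗᵢ[ℂ] Fock (Paths S) :=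
  (orthonormal_beamSplitterKet hunit).orthogonalFamily.linearIsometry

/-- The joint output of the beam splitter for a finite-particle input vector. -/
def outVec (hunit : η ^ 2 + ζ ^ 2 = 1) (γ : ℂ) : FiniteVec (Fin S) →ₗ[ℂ] Fock (Paths S) :=
  (bsIsometry hunit).toLinearMap ∘ₗ jointVec γ

/-- Links the abstract isometry to the explicit series over input occupations in `outputProb`. -/
lemma hasSum_outVec (hunit : η ^ 2 + ζ ^ 2 = 1) (γ : ℂ) (v : FiniteVec (Fin S))
    (z : Occ (Paths S)) :
    HasSum (fun x => jointVec γ v x * beamSplitterKet η ζ x z) (outVec hunit γ v z) := by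
  have h := (orthonormal_beamSplitterKet hunit).orthogonalFamily.hasSum_linearIsometry
    (jointVec γ v)
  have h2 := h.mapL (innerSL ℂ (ket z))
  simp only [innerSL_apply_apply, inner_ket] at h2
  refine h2.congr_fun fun x => ?_
  simp [toFock_apply]

lemma hasSum_inner_outVec (hunit : η ^ 2 + ζ ^ 2 = 1) (γ : ℂ) (u v : FiniteVec (Fin S)) :
    HasSum (fun z => star (outVec hunit γ u z) * outVec hunit γ v z)
      (inner ℂ (toFock u) (toFock v)) := by
  rw [← inner_jointVec γ, ← (bsIsometry hunit).inner_map_map]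
  refine (lp.hasSum_inner (outVec hunit γ u) (outVec hunit γ v)).congr_fun fun z => ?_
  simp [mul_comm]

variable (η ζ) in
/-- The mode operator `η aᵢ + ζ vᵢ`, where `v = γ e₁`. -/
def shiftedAnnih (γ : ℂ) (i : Fin S) : Module.End ℂ (FiniteVec (Fin S)) :=
  (η : ℂ) • annih i + ((ζ : ℂ) * (Pi.single 0 γ : Fin S → ℂ) i) • 1

/-- The left side is the coordinate at `z` of the output annihilator. The recursion for the matrix
elements splits it into an input part, where `annih i` acts, and a probe part, where the coherent
state gives its eigenvalue. -/
lemma sqrt_mul_outVec (hunit : η ^ 2 + ζ ^ 2 = 1) (γ : ℂ) (v : FiniteVec (Fin S))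
    (z : Occ (Paths S)) (i : Fin S) :
    ((Real.sqrt (z (Sum.inl i) + 1) : ℝ) : ℂ) * outVec hunit γ v (z + Pi.single (Sum.inl i) 1) =
      outVec hunit γ (shiftedAnnih η ζ γ i v) z := by
  have h := (hasSum_outVec hunit γ v (z + Pi.single (Sum.inl i) 1)).mul_left
    ((Real.sqrt (z (Sum.inl i) + 1) : ℝ) : ℂ)
  refine h.unique ?_
  -- Shifting the summation index moves the removed photon from the matrix element of the splitter
  -- to the input vector.
  have h1 : HasSum (fun x : Occ (Paths S) => jointVec γ v x *
      (((Real.sqrt (x (Sum.inl i)) : ℝ) : ℂ) *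
        beamSplitterKet η ζ (x - Pi.single (Sum.inl i) 1) z)) (outVec hunit γ (annih i v) z) := by
    rw [← hasSum_shift_iff (Sum.inl i)]
    · refine (hasSum_outVec hunit γ (annih i v) z).congr_fun fun x => ?_
      rw [← sqrt_mul_jointVec_inl, add_tsub_cancel_right]
      simp
      ring
    · intro x hx; simp [hx]
  have h2 : HasSum (fun x : Occ (Paths S) => jointVec γ v x *
      (((Real.sqrt (x (Sum.inr i)) : ℝ) : ℂ) *
        beamSplitterKet η ζ (x - Pi.single (Sum.inr i) 1) z))
      ((Pi.single 0 γ : Fin S → ℂ) i * outVec hunit γ v z) := by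
    rw [← hasSum_shift_iff (Sum.inr i)]
    · refine ((hasSum_outVec hunit γ v z).mul_left ((Pi.single 0 γ : Fin S → ℂ) i)).congr_fun
        fun x => ?_
      rw [← mul_assoc _ (jointVec γ v x), ← sqrt_mul_jointVec_inr, add_tsub_cancel_right]
      simp
      ring
    · intro x hx; simp [hx]
  have h3 := (h1.mul_left (η : ℂ)).add (h2.mul_left (ζ : ℂ))
  have e : outVec hunit γ (shiftedAnnih η ζ γ i v) z = (η : ℂ) * outVec hunit γ (annih i v) z +
      (ζ : ℂ) * ((Pi.single 0 γ : Fin S → ℂ) i * outVec hunit γ v z) := by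
    rw [← mul_assoc]
    simp [shiftedAnnih]
    rfl
  rw [e]
  refine h3.congr_fun fun x => ?_
  rw [mul_left_comm, sqrt_mul_beamSplitterKet]
  ring

end Coherent

/-! ### Normal ordering and its matrix elements. -/

section NormalOrder

variable {S : ℕ}

/-- The normally ordered word with exponents `s`. -/
def normalWord (s : Fin S ⊕ Fin S →₀ ℕ) : Module.End ℂ (FiniteVec (Fin S)) :=
  (List.ofFn fun i : Fin S => create i ^ s (Sum.inr i)).prod *
    (List.ofFn fun i : Fin S => annih i ^ s (Sum.inl i)).prod

/-- Normal ordering as a linear map. -/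
def normalOrderHom : Symbol S →ₗ[ℂ] Module.End ℂ (FiniteVec (Fin S)) where
  toFun := normalOrder
  map_add' p q := by
    have h : ∀ p : Symbol S, normalOrder p =
        (AddMonoidAlgebra.coeff p).sum fun s c => c • normalWord s := fun p => by
      rw [MvPolynomial.sum_def]; rfl
    rw [h, h, h, AddMonoidAlgebra.coeff_add, Finsupp.sum_add_index'] <;>
    simp [add_smul]
  map_smul' c p := by
    have h : ∀ p : Symbol S, normalOrder p =
        (AddMonoidAlgebra.coeff p).sum fun s c => c • normalWord s := fun p => by
      rw [MvPolynomial.sum_def]; rfl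
    rw [h, h, AddMonoidAlgebra.coeff_smul, Finsupp.sum_smul_index', Finsupp.smul_sum] <;>
    simp [mul_smul]

lemma normalOrderHom_apply (p : Symbol S) : normalOrderHom p = normalOrder p := rfl

lemma normalOrderHom_monomial (s : Fin S ⊕ Fin S →₀ ℕ) (c : ℂ) :
    normalOrderHom (MvPolynomial.monomial s c) = c • normalWord s := by
  rw [normalOrderHom_apply, normalOrder]
  by_cases hc : c = 0
  · simp [hc]
  · rw [MvPolynomial.support_monomial, if_neg hc, Finset.sum_singleton,
      MvPolynomial.coeff_monomial, if_pos rfl]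
    rfl

lemma normalWord_add_inl (s : Fin S ⊕ Fin S →₀ ℕ) (i : Fin S) :
    normalWord (Finsupp.single (Sum.inl i) 1 + s) = normalWord s * annih i := by
  have h := list_prod_ofFn_pow_add_single (fun i : Fin S => annih i) annih_commute
    (fun k => s (Sum.inl k)) i
  have hc := commute_list_prod_ofFn_pow (fun i : Fin S => annih i) (annih i) (annih_commute i)
    (fun k => s (Sum.inl k))
  unfold normalWord
  rw [mul_assoc, ← hc.eq, ← h]
  simp [Finsupp.single_apply, Pi.single_apply, add_comm, eq_comm]

lemma normalWord_add_inr (s : Fin S ⊕ Fin S →₀ ℕ) (i : Fin S) :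
    normalWord (Finsupp.single (Sum.inr i) 1 + s) = create i * normalWord s := by
  have h := list_prod_ofFn_pow_add_single (fun i : Fin S => create i) create_commute
    (fun k => s (Sum.inr k)) i
  unfold normalWord
  rw [← mul_assoc, ← h]
  simp [Finsupp.single_apply, Pi.single_apply, add_comm, eq_comm]

lemma normalOrderHom_al_mul (i : Fin S) (p : Symbol S) :
    normalOrderHom (al i * p) = normalOrderHom p * annih i := by
  induction p using MvPolynomial.induction_on' with
  | monomial s c =>
    rw [al, MvPolynomial.X, MvPolynomial.monomial_mul, one_mul, normalOrderHom_monomial,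
      normalOrderHom_monomial, normalWord_add_inl, smul_mul_assoc]
  | add p q hp hq => rw [mul_add, map_add, hp, hq, map_add, add_mul]

lemma normalOrderHom_alStar_mul (i : Fin S) (p : Symbol S) :
    normalOrderHom (alStar i * p) = create i * normalOrderHom p := by
  induction p using MvPolynomial.induction_on' with
  | monomial s c =>
    rw [alStar, MvPolynomial.X, MvPolynomial.monomial_mul, one_mul, normalOrderHom_monomial,
      normalOrderHom_monomial, normalWord_add_inr, mul_smul_comm]
  | add p q hp hq => rw [mul_add, map_add, hp, hq, map_add, mul_add]

lemma normalOrderHom_one : normalOrderHom (1 : Symbol S) = 1 := by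
  rw [← MvPolynomial.C_1, ← MvPolynomial.monomial_zero', normalOrderHom_monomial]
  simp [normalWord]

/-- The matrix element of a normally ordered operator, as a linear functional of its symbol. -/
def matrixElement (u v : FiniteVec (Fin S)) : Symbol S →ₗ[ℂ] ℂ :=
  (innerSL ℂ (toFock u)).toLinearMap ∘ₗ toFock ∘ₗ LinearMap.applyₗ v ∘ₗ normalOrderHom

lemma matrixElement_apply (u v : FiniteVec (Fin S)) (p : Symbol S) :
    matrixElement u v p = inner ℂ (toFock u) (toFock (normalOrderHom p v)) := rfl

lemma matrixElement_al_mul (u v : FiniteVec (Fin S)) (i : Fin S) (p : Symbol S) :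
    matrixElement u v (al i * p) = matrixElement u (annih i v) p := by
  rw [matrixElement_apply, normalOrderHom_al_mul]; rfl

lemma matrixElement_alStar_mul (u v : FiniteVec (Fin S)) (i : Fin S) (p : Symbol S) :
    matrixElement u v (alStar i * p) = matrixElement (annih i u) v p := by
  rw [matrixElement_apply, normalOrderHom_alStar_mul, Module.End.mul_apply, inner_create_right]
  rfl

lemma matrixElement_C_mul (u v : FiniteVec (Fin S)) (c : ℂ) (p : Symbol S) :
    matrixElement u v (MvPolynomial.C c * p) = c * matrixElement u v p := by
  rw [MvPolynomial.C_mul', map_smul, smul_eq_mul]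

lemma matrixElement_one (u v : FiniteVec (Fin S)) :
    matrixElement u v 1 = inner ℂ (toFock u) (toFock v) := by
  rw [matrixElement_apply, normalOrderHom_one]; rfl

/-- Normal ordering lets the unstarred factor act on the ket and the starred one, as its adjoint, on
the bra, so a factor of the symbol can be peeled off without commutators. -/
lemma matrixElement_shifted (u v : FiniteVec (Fin S)) (i : Fin S) (c d : ℂ) (p : Symbol S) :
    matrixElement u v ((MvPolynomial.C (star c) * alStar i + MvPolynomial.C (star d)) *
        (MvPolynomial.C c * al i + MvPolynomial.C d) * p) =
      matrixElement ((c • annih i + d • 1 : Module.End ℂ (FiniteVec (Fin S))) u)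
        ((c • annih i + d • 1 : Module.End ℂ (FiniteVec (Fin S))) v) p := by
  have h1 : (MvPolynomial.C (star c) * alStar i + MvPolynomial.C (star d)) *
      (MvPolynomial.C c * al i + MvPolynomial.C d) * p =
      MvPolynomial.C (star c) * (alStar i * (MvPolynomial.C c * (al i * p))) +
      MvPolynomial.C (star c) * (alStar i * (MvPolynomial.C d * p)) +
      MvPolynomial.C (star d) * (MvPolynomial.C c * (al i * p)) +
      MvPolynomial.C (star d) * (MvPolynomial.C d * p) := by ring
  rw [h1]
  simp only [map_add, matrixElement_C_mul, matrixElement_alStar_mul, matrixElement_al_mul]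
  simp only [matrixElement_apply, LinearMap.add_apply, LinearMap.smul_apply, map_add, map_smul,
    Module.End.one_apply, inner_add_left, inner_add_right, inner_smul_left, inner_smul_right,
    starRingEnd_apply]
  ring

/-! ### Factorial moments of the photon count. -/

section Moments

variable [NeZero S] (η ζ : ℝ)

/-- The symbol of the photon number in the first output path, for the probe amplitude `γ`. -/
def outputNumber (S : ℕ) [NeZero S] (η ζ : ℝ) (γ : ℂ) : Symbol S :=
  ∑ i : Fin S,
    (MvPolynomial.C (star (η : ℂ)) * alStar i +
      MvPolynomial.C (star ((ζ : ℂ) * (Pi.single 0 γ : Fin S → ℂ) i))) *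
    (MvPolynomial.C (η : ℂ) * al i + MvPolynomial.C ((ζ : ℂ) * (Pi.single 0 γ : Fin S → ℂ) i))

lemma matrixElement_outputNumber_mul (γ : ℂ) (u v : FiniteVec (Fin S)) (p : Symbol S) :
    matrixElement u v (outputNumber S η ζ γ * p) =
      ∑ i, matrixElement (shiftedAnnih η ζ γ i u) (shiftedAnnih η ζ γ i v) p := by
  rw [outputNumber, Finset.sum_mul, map_sum]
  exact Finset.sum_congr rfl fun i _ => matrixElement_shifted u v i _ _ p

variable {η ζ}

/-- The photon number in the first output path. -/
def firstCount (z : Occ (Paths S)) : ℕ := ∑ i, z (Sum.inl i)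

/-- Induction on `n`: the falling factorial of k is k times that of k - 1, and k = ∑ zᵢ. For each i,
shifting z by eᵢ turns zᵢ into √(zᵢ + 1)², one root for each of the two output vectors. -/
lemma hasSum_descFactorial_outVec (hunit : η ^ 2 + ζ ^ 2 = 1) (γ : ℂ) (n : ℕ)
    (u v : FiniteVec (Fin S)) :
    HasSum (fun z => ((firstCount z).descFactorial n : ℂ) *
        (star (outVec hunit γ u z) * outVec hunit γ v z))
      (matrixElement u v (outputNumber S η ζ γ ^ n)) := by
  induction n generalizing u v with
  | zero =>
    rw [pow_zero, matrixElement_one]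
    exact (hasSum_inner_outVec hunit γ u v).congr_fun fun z => by simp
  | succ n ih =>
    rw [pow_succ', matrixElement_outputNumber_mul]
    have h1 : ∀ i : Fin S, HasSum (fun z : Occ (Paths S) => (z (Sum.inl i) : ℂ) *
        (((firstCount z - 1).descFactorial n : ℂ) *
          (star (outVec hunit γ u z) * outVec hunit γ v z)))
        (matrixElement (shiftedAnnih η ζ γ i u) (shiftedAnnih η ζ γ i v)
          (outputNumber S η ζ γ ^ n)) := by
      intro i
      rw [← hasSum_shift_iff (Sum.inl i)]
      · refine (ih _ _).congr_fun fun z => ?_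
        have h2 : firstCount (z + Pi.single (Sum.inl i) 1 : Occ (Paths S)) - 1 = firstCount z := by
          simp [firstCount, Finset.sum_add_distrib, Pi.single_apply]
        have h3 : (((z + Pi.single (Sum.inl i) 1 : Occ (Paths S)) (Sum.inl i) : ℕ) : ℂ) =
            ((Real.sqrt (z (Sum.inl i) + 1) : ℝ) : ℂ) *
              ((Real.sqrt (z (Sum.inl i) + 1) : ℝ) : ℂ) := by
          rw [← Complex.ofReal_mul, Real.mul_self_sqrt (by positivity)]
          simp
        rw [h2, h3, ← sqrt_mul_outVec, ← sqrt_mul_outVec, star_mul', Complex.star_def,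
          Complex.conj_ofReal]
        ring
      · intro z hz; simp [hz]
    refine (hasSum_sum fun i (_ : i ∈ Finset.univ) => h1 i).congr_fun fun z => ?_
    -- At count zero the truncated `firstCount z - 1` is harmless, as the factor in front vanishes.
    have key : ((firstCount z).descFactorial (n + 1) : ℂ) =
        (firstCount z : ℂ) * ((firstCount z - 1).descFactorial n : ℂ) := by
      rcases Nat.eq_zero_or_pos (firstCount z) with h | h
      · simp [h]
      · obtain ⟨m, hm⟩ := Nat.exists_eq_succ_of_ne_zero h.ne'
        rw [hm, Nat.succ_descFactorial_succ]
        simp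
    rw [← Finset.sum_mul, ← Nat.cast_sum, key, mul_assoc]
    rfl

end Moments

end NormalOrder

/-! ### From matrix elements to states and counter distributions. -/

section States

variable {S : ℕ} {N : ℕ} {ρ : Fock (Fin S) →L[ℂ] Fock (Fin S)}

/-- The matrix elements of an operator in the Fock basis. -/
def rhoElem (ρ : Fock (Fin S) →L[ℂ] Fock (Fin S)) (m n : Occ (Fin S)) : ℂ :=
  inner ℂ (ket m) (ρ (ket n))

/-- The Fock states with at most `N` photons in each mode. -/
def occBox (S N : ℕ) : Finset (Occ (Fin S)) := Fintype.piFinset fun _ => Finset.range (N + 1)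

/-- The box contains every Fock state with at most N photons, so sums over it lose nothing; ρ
vanishes on its surplus members. -/
lemma photons_of_notMem_occBox {m : Occ (Fin S)} (hm : m ∉ occBox S N) : N < ∑ i, m i := by
  simp only [occBox, Fintype.mem_piFinset, Finset.mem_range, not_forall, not_lt] at hm
  obtain ⟨i, hi⟩ := hm
  exact lt_of_lt_of_le hi (Finset.single_le_sum (fun _ _ => Nat.zero_le _) (Finset.mem_univ i))

lemma star_rhoElem (hρ : IsDensity ρ) (m n : Occ (Fin S)) :
    star (rhoElem ρ m n) = rhoElem ρ n m := by
  rw [rhoElem, rhoElem, Complex.star_def, inner_conj_symm]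
  exact hρ.1.isSymmetric _ _

lemma rhoElem_eq_zero_right (hN : HasMaxPhotons N ρ) (m : Occ (Fin S)) {n : Occ (Fin S)}
    (hn : N < ∑ i, n i) : rhoElem ρ m n = 0 := by
  simp [rhoElem, hN n hn]

lemma rhoElem_eq_zero_left (hρ : IsDensity ρ) (hN : HasMaxPhotons N ρ) {m : Occ (Fin S)}
    (n : Occ (Fin S)) (hm : N < ∑ i, m i) : rhoElem ρ m n = 0 := by
  rw [← star_rhoElem hρ, rhoElem_eq_zero_right hN n hm, star_zero]

lemma inner_ket_apply_toFock (hN : HasMaxPhotons N ρ) (m : Occ (Fin S)) (w : FiniteVec (Fin S)) :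
    inner ℂ (ket m) (ρ (toFock w)) = ∑ n ∈ occBox S N, rhoElem ρ m n * w n := by
  induction w using Finsupp.induction_linear with
  | zero => simp
  | add u w hu hw => simp [map_add, hu, hw, mul_add, Finset.sum_add_distrib]
  | single n c =>
    rw [toFock_single, map_smul, inner_smul_right]
    simp only [Finsupp.single_apply, mul_ite, mul_zero, Finset.sum_ite_eq]
    by_cases hn : n ∈ occBox S N
    · rw [if_pos hn, mul_comm]; rfl
    · rw [if_neg hn, hN n (photons_of_notMem_occBox hn)]; simp

/-- The expectation of a normally ordered operator, as a linear functional of its symbol. -/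
def momentFunctional (N : ℕ) (ρ : Fock (Fin S) →L[ℂ] Fock (Fin S)) : Symbol S →ₗ[ℂ] ℂ :=
  ∑ m ∈ occBox S N, ∑ n ∈ occBox S N,
    rhoElem ρ m n • matrixElement (Finsupp.single n 1) (Finsupp.single m 1)

lemma momentFunctional_apply (p : Symbol S) : momentFunctional N ρ p =
    ∑ m ∈ occBox S N, ∑ n ∈ occBox S N,
      rhoElem ρ m n * matrixElement (Finsupp.single n 1) (Finsupp.single m 1) p := by
  simp [momentFunctional]

lemma expectation_normalOrder (hρ : IsDensity ρ) (hN : HasMaxPhotons N ρ) (p : Symbol S) :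
    expectation ρ (normalOrder p) = momentFunctional N ρ p := by
  rw [expectation, momentFunctional_apply]
  simp only [inner_ket_apply_toFock hN, matrixElement_apply, inner_single_toFock, star_one,
    one_mul, normalOrderHom_apply]
  refine tsum_eq_sum fun m hm => Finset.sum_eq_zero fun n _ => ?_
  rw [rhoElem_eq_zero_left hρ hN n (photons_of_notMem_occBox hm), zero_mul]

variable [NeZero S] {η ζ : ℝ}

lemma jointInput_eq (hρ : IsDensity ρ) (hN : HasMaxPhotons N ρ) (γ : ℂ) (x y : Occ (Paths S)) :
    jointInput ρ (Pi.single 0 γ) x y = ∑ m ∈ occBox S N, ∑ n ∈ occBox S N,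
      rhoElem ρ m n * (jointVec γ (Finsupp.single m 1) x *
        star (jointVec γ (Finsupp.single n 1) y)) := by
  have h : ∀ m n, rhoElem ρ m n * (jointVec γ (Finsupp.single m 1) x *
        star (jointVec γ (Finsupp.single n 1) y)) =
      if n = y ∘ Sum.inl then (if m = x ∘ Sum.inl then
        jointInput ρ (Pi.single 0 γ) x y else 0) else 0 := by
    intro m n
    rw [jointVec_apply, jointVec_apply, Finsupp.single_apply, Finsupp.single_apply]
    by_cases hm : m = x ∘ Sum.inl
    · by_cases hn : n = y ∘ Sum.inl
      · simp [hm, hn, jointInput, rhoElem]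
      · simp [hn]
    · simp [hm]
  simp only [h, Finset.sum_ite_eq']
  by_cases hy : y ∘ Sum.inl ∈ occBox S N
  · by_cases hx : x ∘ Sum.inl ∈ occBox S N
    · simp [hy, hx]
    · have := rhoElem_eq_zero_left hρ hN (y ∘ Sum.inl) (photons_of_notMem_occBox hx)
      simp only [rhoElem] at this
      simp [jointInput, this]
  · have := rhoElem_eq_zero_right hN (x ∘ Sum.inl) (photons_of_notMem_occBox hy)
    simp only [rhoElem] at this
    simp [jointInput, this]

lemma outputProb_eq (hunit : η ^ 2 + ζ ^ 2 = 1) (hρ : IsDensity ρ) (hN : HasMaxPhotons N ρ)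
    (γ : ℂ) (z : Occ (Paths S)) :
    (outputProb η ζ ρ (Pi.single 0 γ) z : ℂ) = ∑ m ∈ occBox S N, ∑ n ∈ occBox S N,
      rhoElem ρ m n * (outVec hunit γ (Finsupp.single m 1) z *
        star (outVec hunit γ (Finsupp.single n 1) z)) := by
  have h1 : ∀ x : Occ (Paths S), HasSum (fun y => beamSplitterKet η ζ x z *
      jointInput ρ (Pi.single 0 γ) x y * star (beamSplitterKet η ζ y z))
      (∑ m ∈ occBox S N, ∑ n ∈ occBox S N, rhoElem ρ m n *
        (jointVec γ (Finsupp.single m 1) x * beamSplitterKet η ζ x z) *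
          star (outVec hunit γ (Finsupp.single n 1) z)) := by
    intro x
    refine (hasSum_sum fun m _ => hasSum_sum fun n _ =>
      (hasSum_outVec hunit γ (Finsupp.single n 1) z).star.mul_left (rhoElem ρ m n *
        (jointVec γ (Finsupp.single m 1) x * beamSplitterKet η ζ x z))).congr_fun fun y => ?_
    rw [jointInput_eq hρ hN, Finset.mul_sum, Finset.sum_mul]
    refine Finset.sum_congr rfl fun m _ => ?_
    rw [Finset.mul_sum, Finset.sum_mul]
    refine Finset.sum_congr rfl fun n _ => ?_
    rw [star_mul']
    ring
  have h2 : HasSum (fun x : Occ (Paths S) => ∑' y, beamSplitterKet η ζ x z *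
      jointInput ρ (Pi.single 0 γ) x y * star (beamSplitterKet η ζ y z))
      (∑ m ∈ occBox S N, ∑ n ∈ occBox S N, rhoElem ρ m n *
        (outVec hunit γ (Finsupp.single m 1) z * star (outVec hunit γ (Finsupp.single n 1) z))) := by
    simp only [fun x => (h1 x).tsum_eq, ← mul_assoc]
    refine hasSum_sum fun m _ => hasSum_sum fun n _ => HasSum.mul_right _ ?_
    simp only [mul_assoc]
    exact (hasSum_outVec hunit γ (Finsupp.single m 1) z).mul_left _
  rw [outputProb, h2.tsum_eq]
  -- Taking the real part in `outputProb` discards nothing: ρ is Hermitian, so conjugation merely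
  -- swaps `m` and `n`.
  refine Complex.conj_eq_iff_re.mp ?_
  rw [map_sum]
  simp only [map_sum]
  rw [Finset.sum_comm]
  refine Finset.sum_congr rfl fun m _ => Finset.sum_congr rfl fun n _ => ?_
  rw [← star_rhoElem hρ]
  simp [mul_comm]

lemma hasSum_outputProb (hunit : η ^ 2 + ζ ^ 2 = 1) (hρ : IsDensity ρ) (hN : HasMaxPhotons N ρ)
    (γ : ℂ) (k : ℕ) :
    HasSum (fun z => ((firstCount z).descFactorial k : ℂ) *
        (outputProb η ζ ρ (Pi.single 0 γ) z : ℂ))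
      (momentFunctional N ρ (outputNumber S η ζ γ ^ k)) := by
  rw [momentFunctional_apply]
  refine (hasSum_sum fun m _ => hasSum_sum fun n _ =>
    (hasSum_descFactorial_outVec hunit γ k (Finsupp.single n 1)
      (Finsupp.single m 1)).mul_left (rhoElem ρ m n)).congr_fun fun z => ?_
  rw [outputProb_eq hunit hρ hN, Finset.mul_sum]
  refine Finset.sum_congr rfl fun m _ => ?_
  rw [Finset.mul_sum]
  exact Finset.sum_congr rfl fun n _ => by ring

/-- The factorial moments of the counter distribution are expectations of normally ordered
operators. -/
lemma hasSum_counterProb (hunit : η ^ 2 + ζ ^ 2 = 1) (hρ : IsDensity ρ) (hN : HasMaxPhotons N ρ)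
    (γ : ℂ) (n : ℕ) :
    HasSum (fun k : ℕ => (k.descFactorial n : ℂ) * (counterProb η ζ ρ γ k : ℂ))
      (momentFunctional N ρ (outputNumber S η ζ γ ^ n)) := by
  have h := hasSum_outputProb hunit hρ hN γ n
  rw [← (Equiv.sigmaFiberEquiv (firstCount (S := S))).hasSum_iff] at h
  refine h.sigma fun k => ?_
  -- The zeroth moment supplies summability, without which the `tsum` in `counterProb` could be a
  -- default value.
  have h0 := (hasSum_outputProb hunit hρ hN γ 0).summable
  simp only [Nat.descFactorial_zero, Nat.cast_one, one_mul] at h0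
  have h1 : HasSum (fun z : {z : Occ (Paths S) // firstCount z = k} =>
      (outputProb η ζ ρ (Pi.single 0 γ) z : ℂ)) (counterProb η ζ ρ γ k : ℂ) := by
    rw [counterProb, Complex.ofReal_tsum]
    exact (h0.subtype {z : Occ (Paths S) | firstCount z = k}).hasSum
  refine (h1.mul_left (k.descFactorial n : ℂ)).congr_fun fun z => ?_
  simp [z.2]

end States

/-! ### Monomials that vanish on states with few photons. -/

section Vanishing

variable {S : ℕ}

/-- The vector `v` has fewer than `M` photons. -/
def PhotonsLT (M : ℕ) (v : FiniteVec (Fin S)) : Prop := ∀ n : Occ (Fin S), M ≤ ∑ i, n i → v n = 0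

lemma PhotonsLT.annih {M : ℕ} {v : FiniteVec (Fin S)} (h : PhotonsLT M v) (i : Fin S) :
    PhotonsLT (M - 1) (annih i v) := by
  intro n hn
  rw [annih_apply, h, mul_zero]
  simp only [Pi.add_apply, Finset.sum_add_distrib, Finset.sum_pi_single', Finset.mem_univ, if_true]
  omega

lemma PhotonsLT.eq_zero {v : FiniteVec (Fin S)} (h : PhotonsLT 0 v) : v = 0 :=
  Finsupp.ext fun n => h n (Nat.zero_le _)

lemma photonsLT_single {N : ℕ} {m : Occ (Fin S)} (hm : ∑ i, m i ≤ N) :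
    PhotonsLT (N + 1) (Finsupp.single m (1 : ℂ)) := by
  intro n hn
  rw [Finsupp.single_apply, if_neg]
  rintro rfl
  omega

variable [NeZero S]

lemma mMono_succ_left (a b c : ℕ) : (mMono (a + 1) b c : Symbol S) =
    ∑ i, al i * (alStar i * mMono a b c) := by
  simp only [mMono, pow_succ', Finset.sum_mul]
  exact Finset.sum_congr rfl fun i _ => by ring

lemma mMono_succ_mid (a b c : ℕ) : (mMono a (b + 1) c : Symbol S) = al 0 * mMono a b c := by
  rw [mMono, mMono]; ring

lemma mMono_succ_right (a b c : ℕ) : (mMono a b (c + 1) : Symbol S) = alStar 0 * mMono a b c := by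
  rw [mMono, mMono]; ring

/-- Each αᵢαᵢ* and each α₁ takes one photon from the ket, a + b in all, which leaves nothing. -/
lemma matrixElement_mMono_of_right {M a b c : ℕ} {u v : FiniteVec (Fin S)} (hv : PhotonsLT M v)
    (h : M ≤ a + b) : matrixElement u v (mMono a b c) = 0 := by
  induction a generalizing M u v with
  | zero =>
    induction b generalizing M v with
    | zero =>
      obtain rfl : M = 0 := by omega
      simp [hv.eq_zero, matrixElement_apply]
    | succ b ih =>
      rw [mMono_succ_mid, matrixElement_al_mul]
      exact ih (hv.annih 0) (by omega)
  | succ a ih =>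
    rw [mMono_succ_left, map_sum]
    refine Finset.sum_eq_zero fun i _ => ?_
    rw [matrixElement_al_mul, matrixElement_alStar_mul]
    exact ih (hv.annih i) (by omega)

lemma matrixElement_mMono_of_left {M a b c : ℕ} {u v : FiniteVec (Fin S)} (hu : PhotonsLT M u)
    (h : M ≤ a + c) : matrixElement u v (mMono a b c) = 0 := by
  induction a generalizing M u v with
  | zero =>
    induction c generalizing M u with
    | zero =>
      obtain rfl : M = 0 := by omega
      simp [hu.eq_zero, matrixElement_apply]
    | succ c ih =>
      rw [mMono_succ_right, matrixElement_alStar_mul]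
      exact ih (hu.annih 0) (by omega)
  | succ a ih =>
    rw [mMono_succ_left, map_sum]
    refine Finset.sum_eq_zero fun i _ => ?_
    rw [matrixElement_al_mul, matrixElement_alStar_mul]
    exact ih (hu.annih i) (by omega)

lemma momentFunctional_mMono_eq_zero {N : ℕ} {ρ : Fock (Fin S) →L[ℂ] Fock (Fin S)}
    (hρ : IsDensity ρ) (hN : HasMaxPhotons N ρ) {a b c : ℕ} (h : N < a + max b c) :
    momentFunctional N ρ (mMono a b c) = 0 := by
  rw [momentFunctional_apply]
  refine Finset.sum_eq_zero fun m _ => Finset.sum_eq_zero fun n _ => ?_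
  by_cases hm : N < ∑ i, m i
  · rw [rhoElem_eq_zero_left hρ hN n hm, zero_mul]
  by_cases hn : N < ∑ i, n i
  · rw [rhoElem_eq_zero_right hN m hn, zero_mul]
  rcases le_total b c with hbc | hbc
  · rw [max_eq_right hbc] at h
    rw [matrixElement_mMono_of_left (photonsLT_single (not_lt.mp hn)) (by omega), mul_zero]
  · rw [max_eq_left hbc] at h
    rw [matrixElement_mMono_of_right (photonsLT_single (not_lt.mp hm)) (by omega), mul_zero]

end Vanishing

/-! ### Linear independence of the monomials in γ and γ*. -/

section Polynomials

lemma eq_zero_of_sum_mul_pow_eq_zero {n : ℕ} {k : ℕ → ℂ} {s : Set ℂ} (hs : s.Infinite)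
    (h : ∀ x ∈ s, ∑ l ∈ Finset.range n, k l * x ^ l = 0) {l : ℕ} (hl : l < n) : k l = 0 := by
  let p : Polynomial ℂ := ∑ l ∈ Finset.range n, Polynomial.C (k l) * Polynomial.X ^ l
  have hp : p = 0 := by
    refine Polynomial.eq_zero_of_infinite_isRoot p (hs.mono fun x hx => ?_)
    simpa [p, Polynomial.eval_finsetSum] using h x hx
  have h2 : p.coeff l = k l := by
    simp [p, Polynomial.coeff_X_pow, hl]
  rw [← h2, hp, Polynomial.coeff_zero]

lemma infinite_range_ofReal : (Set.range ((↑) : ℝ → ℂ)).Infinite :=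
  Set.infinite_range_of_injective Complex.ofReal_injective

lemma one_add_mul_I_ne_zero (t : ℝ) : 1 + (t : ℂ) * Complex.I ≠ 0 := by
  intro h
  simpa using congrArg Complex.re h

lemma infinite_range_star_div :
    (Set.range fun t : ℝ => star (1 + (t : ℂ) * Complex.I) / (1 + (t : ℂ) * Complex.I)).Infinite := by
  refine Set.infinite_range_of_injective fun s t h => ?_
  rw [div_eq_div_iff (one_add_mul_I_ne_zero s) (one_add_mul_I_ne_zero t)] at h
  have := congrArg Complex.im h
  simp at this
  linarith

/-- The monomials in `γ` and `γ*` are linearly independent as functions on `ℂ`. -/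
lemma eq_zero_of_sum_star_mul_eq_zero {n : ℕ} {k : ℕ → ℕ → ℂ}
    (h : ∀ γ : ℂ, ∑ j ∈ Finset.range n, ∑ l ∈ Finset.range (j + 1),
      k j l * (star γ ^ l * γ ^ (j - l)) = 0) {j l : ℕ} (hj : j < n) (hl : l ≤ j) :
    k j l = 0 := by
  refine eq_zero_of_sum_mul_pow_eq_zero infinite_range_star_div (n := j + 1) ?_
    (Nat.lt_succ_of_le hl)
  rintro _ ⟨t, rfl⟩
  set w : ℂ := 1 + (t : ℂ) * Complex.I
  have hw0 : w ≠ 0 := one_add_mul_I_ne_zero t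
  -- On the real line through `w` the sum is a polynomial in r, whose coefficients are the parts
  -- homogeneous of degree j.
  have h1 : ∑ l ∈ Finset.range (j + 1), k j l * (star w ^ l * w ^ (j - l)) = 0 := by
    refine eq_zero_of_sum_mul_pow_eq_zero (n := n)
      (k := fun j => ∑ l ∈ Finset.range (j + 1), k j l * (star w ^ l * w ^ (j - l)))
      infinite_range_ofReal ?_ hj
    rintro _ ⟨r, rfl⟩
    rw [← h (r * w)]
    refine Finset.sum_congr rfl fun j _ => ?_
    rw [Finset.sum_mul]
    refine Finset.sum_congr rfl fun l hl => ?_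
    have hl' : l + (j - l) = j := by have := Finset.mem_range.mp hl; omega
    have hr : (r : ℂ) ^ j = r ^ l * r ^ (j - l) := by rw [← pow_add, hl']
    rw [star_mul', Complex.star_def, Complex.conj_ofReal, mul_pow, mul_pow, hr]
    ring
  -- Dividing by w^j leaves a polynomial in w*/w, which takes infinitely many values for w = 1 + ti.
  refine (mul_eq_zero.mp (?_ : w ^ j * _ = 0)).resolve_left (pow_ne_zero j hw0)
  rw [← h1, Finset.mul_sum]
  refine Finset.sum_congr rfl fun l hl => ?_
  have hl' : l + (j - l) = j := by have := Finset.mem_range.mp hl; omega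
  have hr : w ^ j = w ^ l * w ^ (j - l) := by rw [← pow_add, hl']
  change w ^ j * (k j l * (star w / w) ^ l) = _
  rw [hr, div_pow]
  field_simp

end Polynomials

/-! ### Extraction of the moments from the amplitudes in Γ. -/

section Main

variable {S : ℕ} [NeZero S] {η ζ : ℝ}

/-- The part of `outputNumber` that involves the input state. -/
def reducedNumber (S : ℕ) [NeZero S] (η ζ : ℝ) (γ : ℂ) : Symbol S :=
  MvPolynomial.C ((η : ℂ) ^ 2) * (∑ i : Fin S, al i * alStar i) +
    MvPolynomial.C ((η : ℂ) * ζ) *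
      (MvPolynomial.C (star γ) * al 0 + MvPolynomial.C γ * alStar 0)

lemma outputNumber_eq (γ : ℂ) : outputNumber S η ζ γ =
    reducedNumber S η ζ γ + MvPolynomial.C ((ζ : ℂ) ^ 2 * (star γ * γ)) := by
  have h : ∀ i : Fin S, (MvPolynomial.C (star (η : ℂ)) * alStar i +
      MvPolynomial.C (star ((ζ : ℂ) * (Pi.single 0 γ : Fin S → ℂ) i))) *
      (MvPolynomial.C (η : ℂ) * al i + MvPolynomial.C ((ζ : ℂ) * (Pi.single 0 γ : Fin S → ℂ) i)) =
      MvPolynomial.C ((η : ℂ) ^ 2) * (al i * alStar i) +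
        if i = 0 then MvPolynomial.C ((η : ℂ) * ζ) *
          (MvPolynomial.C (star γ) * al i + MvPolynomial.C γ * alStar i) +
            MvPolynomial.C ((ζ : ℂ) ^ 2 * (star γ * γ)) else 0 := by
    intro i
    by_cases hi : i = 0
    · subst hi
      simp only [Pi.single_eq_same, if_true, star_mul', Complex.star_def, Complex.conj_ofReal,
        map_mul, map_pow]
      ring
    · simp only [Pi.single_eq_of_ne hi, if_neg hi, mul_zero, star_zero, map_zero, add_zero,
        Complex.star_def, Complex.conj_ofReal, map_pow]
      ring
  rw [outputNumber, Finset.sum_congr rfl fun i _ => h i, Finset.sum_add_distrib,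
    ← Finset.mul_sum, Finset.sum_ite_eq', if_pos (Finset.mem_univ _), reducedNumber]
  ring

lemma reducedNumber_pow (γ : ℂ) (n : ℕ) : reducedNumber S η ζ γ ^ n =
    ∑ j ∈ Finset.range (n + 1), ∑ l ∈ Finset.range (j + 1),
      MvPolynomial.C ((n.choose j * j.choose l * ((η : ℂ) ^ 2) ^ (n - j) * ((η : ℂ) * ζ) ^ j) *
        (star γ ^ l * γ ^ (j - l))) * mMono (n - j) l (j - l) := by
  rw [reducedNumber, add_comm, add_pow]
  refine Finset.sum_congr rfl fun j _ => ?_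
  rw [mul_pow, mul_pow, add_pow, Finset.mul_sum, Finset.sum_mul, Finset.sum_mul]
  refine Finset.sum_congr rfl fun l _ => ?_
  simp only [mMono, map_mul, map_pow, map_natCast, mul_pow]
  ring

/-- The two symbols differ by a scalar, so powers of one are linear combinations of powers of the
other. -/
lemma functional_reducedNumber_pow {e : Symbol S →ₗ[ℂ] ℂ} {γ : ℂ}
    (he : ∀ n, e (outputNumber S η ζ γ ^ n) = 0) (n : ℕ) :
    e (reducedNumber S η ζ γ ^ n) = 0 := by
  rw [← add_sub_cancel_right (reducedNumber S η ζ γ)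
    (MvPolynomial.C ((ζ : ℂ) ^ 2 * (star γ * γ))), ← outputNumber_eq, sub_eq_add_neg, add_pow,
    map_sum]
  refine Finset.sum_eq_zero fun m _ => ?_
  have h : outputNumber S η ζ γ ^ m *
      (-MvPolynomial.C ((ζ : ℂ) ^ 2 * (star γ * γ))) ^ (n - m) * (n.choose m : Symbol S) =
      ((-((ζ : ℂ) ^ 2 * (star γ * γ))) ^ (n - m) * (n.choose m : ℂ)) •
        outputNumber S η ζ γ ^ m := by
    rw [← MvPolynomial.C_mul']
    simp only [map_mul, map_pow, map_neg, map_natCast]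
    ring
  rw [h, map_smul, he, smul_zero]

lemma functional_mMono_eq_zero (hη : η ≠ 0) (hζ : ζ ≠ 0) {N : ℕ} {Γ : Finset ℂ}
    (hΓ : ∀ p ∈ polySpace N, (∀ γ ∈ Γ, p γ = 0) → p = 0) {e : Symbol S →ₗ[ℂ] ℂ}
    (he : ∀ γ ∈ Γ, ∀ n, e (outputNumber S η ζ γ ^ n) = 0)
    (hN : ∀ a b c, N < a + max b c → e (mMono a b c) = 0) (a b c : ℕ) : e (mMono a b c) = 0 := by
  set n := a + b + c with hn
  let w : ℕ → ℕ → ℂ := fun j l =>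
    n.choose j * j.choose l * ((η : ℂ) ^ 2) ^ (n - j) * ((η : ℂ) * ζ) ^ j
  let k : ℕ → ℕ → ℂ := fun j l => w j l * e (mMono (n - j) l (j - l))
  let f : ℂ → ℂ := ∑ j ∈ Finset.range (n + 1), ∑ l ∈ Finset.range (j + 1),
    k j l • fun γ : ℂ => γ ^ (j - l) * star γ ^ l
  have hf : ∀ γ, f γ = e (reducedNumber S η ζ γ ^ n) := by
    intro γ
    rw [reducedNumber_pow]
    simp only [f, map_sum, Finset.sum_apply, Pi.smul_apply, smul_eq_mul, MvPolynomial.C_mul',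
      map_smul, k, w]
    exact Finset.sum_congr rfl fun j _ => Finset.sum_congr rfl fun l _ => by ring
  have hfP : f ∈ polySpace N := by
    refine Submodule.sum_mem _ fun j _ => Submodule.sum_mem _ fun l _ => ?_
    -- Either the coefficient is zero by the photon bound, or both exponents `l` and `j - l` are at
    -- most `N`.
    by_cases h : N < (n - j) + max l (j - l)
    · simp only [k, hN _ _ _ h, mul_zero, zero_smul, Submodule.zero_mem]
    · exact Submodule.smul_mem _ _ (Submodule.subset_span
        ⟨j - l, l, by omega, by omega, rfl⟩)
  have hf0 : f = 0 := hΓ f hfP fun γ hγ => by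
    rw [hf, functional_reducedNumber_pow (he γ hγ)]
  -- With n = a + b + c, the indices j = b + c and l = b single out m(a,b,c).
  have hk : k (b + c) b = 0 := by
    refine eq_zero_of_sum_star_mul_eq_zero (n := n + 1) (k := k) (fun γ => ?_) (by omega) (by omega)
    rw [← show f γ = 0 by rw [hf0]; rfl]
    simp only [f, Finset.sum_apply, Pi.smul_apply, smul_eq_mul]
    exact Finset.sum_congr rfl fun j _ => Finset.sum_congr rfl fun l _ => by ring
  have hw : w (b + c) b ≠ 0 := by
    have h1 : (n.choose (b + c) : ℂ) ≠ 0 :=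
      Nat.cast_ne_zero.mpr (Nat.choose_pos (by omega)).ne'
    have h2 : ((b + c).choose b : ℂ) ≠ 0 :=
      Nat.cast_ne_zero.mpr (Nat.choose_pos (by omega)).ne'
    have h3 : (η : ℂ) ≠ 0 := Complex.ofReal_ne_zero.mpr hη
    have h4 : (ζ : ℂ) ≠ 0 := Complex.ofReal_ne_zero.mpr hζ
    simp only [w]
    positivity
  have h := (mul_eq_zero.mp hk).resolve_left hw
  rwa [show n - (b + c) = a by omega, Nat.add_sub_cancel_left] at h

/-- Binomial expansion of |β|² = |α|² - α₁α₁*: each factor α₁α₁* raises both exponents of mode 1. -/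
lemma mMono'_eq (a b c : ℕ) : (mMono' a b c : Symbol S) =
    ∑ m ∈ Finset.range (a + 1), MvPolynomial.C ((-1) ^ (a - m) * (a.choose m : ℂ)) *
      mMono m (a - m + b) (a - m + c) := by
  have h : ∑ i ∈ (Finset.univ : Finset (Fin S)).erase 0, (al i * alStar i : Symbol S) =
      ∑ i, al i * alStar i + -(al 0 * alStar 0) := by
    rw [← Finset.add_sum_erase _ _ (Finset.mem_univ (0 : Fin S))]; ring
  rw [mMono', h, add_pow, Finset.sum_mul, Finset.sum_mul]
  refine Finset.sum_congr rfl fun m _ => ?_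
  simp only [mMono, map_mul, map_pow, map_neg, map_one, map_natCast]
  rw [neg_pow, mul_pow, pow_add, pow_add]
  ring

lemma functional_mMono'_eq_zero {e : Symbol S →ₗ[ℂ] ℂ}
    (he : ∀ a b c, e (mMono a b c) = 0) (a b c : ℕ) : e (mMono' a b c) = 0 := by
  rw [mMono'_eq, map_sum]
  refine Finset.sum_eq_zero fun m _ => ?_
  rw [MvPolynomial.C_mul', map_smul, he, smul_zero]

lemma observable_of_functional (hη : η ≠ 0) (hζ : ζ ≠ 0) (hunit : η ^ 2 + ζ ^ 2 = 1) {N : ℕ}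
    {Γ : Finset ℂ} (hΓ : ∀ p ∈ polySpace N, (∀ γ ∈ Γ, p γ = 0) → p = 0) {p : Symbol S}
    (hp : ∀ e : Symbol S →ₗ[ℂ] ℂ, (∀ a b c, e (mMono a b c) = 0) → e p = 0) :
    Observable η ζ N Γ p := by
  intro ρ σ hρ hρN hσ hσN h
  rw [expectation_normalOrder hρ hρN, expectation_normalOrder hσ hσN, ← sub_eq_zero,
    ← LinearMap.sub_apply]
  -- The functional is the difference of the two expectations. A series has only one sum, so equal
  -- counter distributions have equal factorial moments.
  refine hp _ (functional_mMono_eq_zero hη hζ hΓ (fun γ hγ n => ?_) fun a b c habc => ?_)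
  · rw [LinearMap.sub_apply, sub_eq_zero]
    refine (hasSum_counterProb hunit hρ hρN γ n).unique ?_
    simpa only [h γ hγ] using hasSum_counterProb hunit hσ hσN γ n
  · rw [LinearMap.sub_apply, momentFunctional_mMono_eq_zero hρ hρN habc,
      momentFunctional_mMono_eq_zero hσ hσN habc, sub_zero]

end Main

end WFH

end

theorem mainTheorem6 (S : ℕ) [NeZero S] (η ζ : ℝ) (hη : η ≠ 0) (hζ : ζ ≠ 0)
    (hunit : η ^ 2 + ζ ^ 2 = 1) (N : ℕ) (Γ : Finset ℂ)
    (hΓ : ∀ p ∈ WFH.polySpace N, (∀ γ ∈ Γ, p γ = 0) → p = 0) :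
    (∀ p ∈ WFH.setM S N, WFH.Observable η ζ N Γ p) ∧
      (∀ p ∈ WFH.setM' S N, WFH.Observable η ζ N Γ p) := by
  refine ⟨?_, ?_⟩
  · rintro p ⟨a, b, c, -, rfl⟩
    exact WFH.observable_of_functional hη hζ hunit hΓ fun e he => he a b c
  · rintro p ⟨a, b, c, -, rfl⟩
    exact WFH.observable_of_functional hη hζ hunit hΓ fun e he =>
      WFH.functional_mMono'_eq_zero he a b c
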